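/- Let $f,h_1,\dots,h_p\colon\mathbb R^n\times\mathbb R^m\to\mathbb R$ be continuously differentiable, let $0\le\ell\le p$, $I:=\{1,\dots,\ell\}$, $J:=\{\ell+1,\dots,p\}$. For $x\in\mathbb R^n$ put \[ \Gamma(x):=\{y\in\mathbb R^m \mid h_i(x,y)\le 0\ (i\in I),\ h_i(x,y)=0\ (i\in J)\},\qquad \varphi(x):=\inf\{f(x,y)\mid y\in\Gamma(x)\}\in\overline{\mathbb R}, \] \[ S(x):=\operatorname{argmin}_y\{f(x,y)\mid y\in\Gamma(x)\},\qquad \operatorname{dom}\Gamma:=\{x\mid\Gamma(x)\neq\varnothing\}. \] We say that RCPLD$_\Gamma$ (the relaxed constant positive linear dependence constraint qualification) holds at $(\bar x,\bar y)$ with $\bar y\in\Gamma(\bar x)$ w.r.t. $\operatorname{dom}\Gamma$ if there are a neighborhood $U$ of $(\bar x,\bar y)$ and a set $B\subset J$ such that (i) the family $(\nabla_yh_i(\bar x,\bar y))_{i\in B}$ is a basis of the span of $\{\nabla_yh_i(\bar x,\bar y)\mid i\in J\}$; (ii) the family $(\nabla_yh_i(x,y))_{i\in J}$ has constant rank on $U\cap(\operatorname{dom}\Gamma\times\mathbb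 R^m)$; (iii) for each $K\subset\{i\in I\mid h_i(\bar x,\bar y)=0\}$ for which there are scalars $\alpha_i\ge0$ $(i\in K)$ and $\beta_i\in\mathbb R$ $(i\in B)$, not all zero, with $\sum_{i\in K}\alpha_i\nabla_yh_i(\bar x,\bar y)+\sum_{i\in B}\beta_i\nabla_yh_i(\bar x,\bar y)=0$, the family $(\nabla_yh_i(x,y))_{i\in K\cup B}$ is linearly dependent for each $(x,y)\in U\cap(\operatorname{dom}\Gamma\times\mathbb R^m)$. Let $\bar x\in\operatorname{dom}\Gamma$, and assume that at least one of the following holds. (a) For each $x\in\mathbb R^n$ the functions $h_i(x,\cdot)$, $i\in I$, are convex and the functions $h_i(x,\cdot)$, $i\in J$, are affine; there are a neighborhood $V$ of $\bar x$ and a bounded set $C\subset\mathbb R^m$ with $\Gamma(x)\subset C$ for all $x\in V$; and RCPLD$_\Gamma$ holds w.r.t. $\operatorname{dom}\Gamma$ at each point of $\{\bar x\}\times\Gamma(\bar x)$. (b) There is $\bar y\in S(\bar x)$ such that $S$ is inner semicontinuous at $(\bar x,\bar y)$ w.r.t. $\operatorname{dom}\Gamma$ (i.e., for each sequence $(x^k)\subset\operatorname{dom}\Gamma$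 with $x^k\to\bar x$ there is a sequence $y^k\to\bar y$ with $y^k\in S(x^k)$ for all sufficiently large $k$), and RCPLD$_\Gamma$ holds w.r.t. $\operatorname{dom}\Gamma$ at $(\bar x,\bar y)$. Then $\varphi$ is locally Lipschitz continuous at $\bar x$ w.r.t. $\operatorname{dom}\Gamma$: there are $\delta>0$ and $L>0$ such that $\varphi$ is finite on $\{x\in\operatorname{dom}\Gamma\mid\|x-\bar x\|<\delta\}$ and $|\varphi(x)-\varphi(x')|\le L\|x-x'\|$ for all $x,x'$ in this set. -/

import Mathlib

open Filter Topology

namespace ParamOpt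

/-- Indices `1, …, ℓ` (shifted to start at `0`) of the inequality constraints among `p` constraints. -/
def ineqIdx (ℓ p : ℕ) : Finset (Fin p) := Finset.univ.filter fun i => (i : ℕ) < ℓ

/-- Indices `ℓ + 1, …, p` (shifted to start at `0`) of the equality constraints. -/
def eqIdx (ℓ p : ℕ) : Finset (Fin p) := Finset.univ.filter fun i => ℓ ≤ (i : ℕ)

/-- The pair of finite families `((a i)_{i ∈ I₁}, (b i)_{i ∈ I₂})` is positive-linearly dependent. -/
def PosLinDep {E ι₁ ι₂ : Type*} [AddCommGroup E] [Module ℝ E]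
    (I₁ : Finset ι₁) (a : ι₁ → E) (I₂ : Finset ι₂) (b : ι₂ → E) : Prop :=
  ∃ (α : ι₁ → ℝ) (β : ι₂ → ℝ), (∀ i ∈ I₁, 0 ≤ α i) ∧
    ((∃ i ∈ I₁, α i ≠ 0) ∨ (∃ i ∈ I₂, β i ≠ 0)) ∧
    ∑ i ∈ I₁, α i • a i + ∑ i ∈ I₂, β i • b i = 0

/-! ### Set-valued mappings -/

/-- The domain of a set-valued mapping. -/
def setDom {X Y : Type*} (Υ : X → Set Y) : Set X := {x | (Υ x).Nonempty}

/-- Local boundedness of a set-valued mapping at a point. -/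
def LocallyBoundedAt {X Y : Type*} [TopologicalSpace X] [Bornology Y]
    (Υ : X → Set Y) (x₀ : X) : Prop :=
  ∃ B : Set Y, Bornology.IsBounded B ∧ ∃ U ∈ 𝓝 x₀, ∀ x ∈ U, Υ x ⊆ B

/-- Inner semicontinuity of a set-valued mapping at a point `(x₀, y₀)` of its graph w.r.t. `Ω`. -/
def InnerSemicontinuousAt {X Y : Type*} [TopologicalSpace X] [TopologicalSpace Y]
    (Υ : X → Set Y) (Ω : Set X) (x₀ : X) (y₀ : Y) : Prop :=
  ∀ x : ℕ → X, (∀ k, x k ∈ Ω) → Tendsto x atTop (𝓝 x₀) →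
    ∃ y : ℕ → Y, Tendsto y atTop (𝓝 y₀) ∧ ∀ᶠ k in atTop, y k ∈ Υ (x k)

/-- An extended-real-valued function is locally Lipschitz continuous at `x₀` w.r.t. `Ω`: on the
part of a ball around `x₀` that lies in `Ω` it takes finite values only, and these satisfy a
Lipschitz estimate. -/
def LocallyLipschitzAtWrt {X : Type*} [NormedAddCommGroup X]
    (φ : X → EReal) (Ω : Set X) (x₀ : X) : Prop :=
  ∃ δ > (0 : ℝ), ∃ L > (0 : ℝ),
    (∀ x ∈ Metric.ball x₀ δ ∩ Ω, φ x ≠ ⊥ ∧ φ x ≠ ⊤) ∧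
    ∀ x ∈ Metric.ball x₀ δ ∩ Ω, ∀ x' ∈ Metric.ball x₀ δ ∩ Ω,
      |(φ x).toReal - (φ x').toReal| ≤ L * ‖x - x'‖

/-! ### The parametric constraint system and the parametric optimization problem

There are `p` constraint functions `h i : ℝⁿ × ℝᵐ → ℝ`; the first `ℓ` of them give inequality
constraints `h i x y ≤ 0`, the others give equality constraints `h i x y = 0`. -/

variable {n m p : ℕ}

/-- The feasible set mapping `Γ`. -/
def feasible (ℓ : ℕ) (h : Fin p → EuclideanSpace ℝ (Fin n) → EuclideanSpace ℝ (Fin m) → ℝ)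
    (x : EuclideanSpace ℝ (Fin n)) : Set (EuclideanSpace ℝ (Fin m)) :=
  {y | (∀ i ∈ ineqIdx ℓ p, h i x y ≤ 0) ∧ (∀ i ∈ eqIdx ℓ p, h i x y = 0)}

/-- The solution mapping `S`. -/
def solution (ℓ : ℕ) (f : EuclideanSpace ℝ (Fin n) → EuclideanSpace ℝ (Fin m) → ℝ)
    (h : Fin p → EuclideanSpace ℝ (Fin n) → EuclideanSpace ℝ (Fin m) → ℝ)
    (x : EuclideanSpace ℝ (Fin n)) : Set (EuclideanSpace ℝ (Fin m)) :=
  {y | y ∈ feasible ℓ h x ∧ ∀ z ∈ feasible ℓ h x, f x y ≤ f x z}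

/-- The optimal value function `φ`, with values in the extended real line. -/
noncomputable def optValue (ℓ : ℕ)
    (f : EuclideanSpace ℝ (Fin n) → EuclideanSpace ℝ (Fin m) → ℝ)
    (h : Fin p → EuclideanSpace ℝ (Fin n) → EuclideanSpace ℝ (Fin m) → ℝ)
    (x : EuclideanSpace ℝ (Fin n)) : EReal :=
  ⨅ y ∈ feasible ℓ h x, (f x y : EReal)

/-- For each parameter, the inequality constraints are convex and the equality constraints are
affine in the decision variable. -/
def ConvexAffine (ℓ : ℕ)
    (h : Fin p → EuclideanSpace ℝ (Fin n) → EuclideanSpace ℝ (Fin m) → ℝ) : Prop :=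
  ∀ x, (∀ i ∈ ineqIdx ℓ p, ConvexOn ℝ Set.univ (h i x)) ∧
    (∀ i ∈ eqIdx ℓ p, ∃ A : EuclideanSpace ℝ (Fin m) →ᵃ[ℝ] ℝ, ∀ y, h i x y = A y)

/-- The indices of the inequality constraints that are active at `(x, y)`. -/
noncomputable def activeIdx (ℓ : ℕ)
    (h : Fin p → EuclideanSpace ℝ (Fin n) → EuclideanSpace ℝ (Fin m) → ℝ)
    (x : EuclideanSpace ℝ (Fin n)) (y : EuclideanSpace ℝ (Fin m)) : Finset (Fin p) :=
  (ineqIdx ℓ p).filter fun i => h i x y = 0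

/-- The family of the partial gradients `∇_y h_i(x, y)`. -/
noncomputable def gradY
    (h : Fin p → EuclideanSpace ℝ (Fin n) → EuclideanSpace ℝ (Fin m) → ℝ)
    (x : EuclideanSpace ℝ (Fin n)) (y : EuclideanSpace ℝ (Fin m)) (i : Fin p) :
    EuclideanSpace ℝ (Fin m) :=
  gradient (h i x) y

/-- The relaxed constant positive linear dependence constraint qualification at `(x₀, y₀)`
w.r.t. `Ω`. -/
def RCPLD (ℓ : ℕ) (h : Fin p → EuclideanSpace ℝ (Fin n) → EuclideanSpace ℝ (Fin m) → ℝ)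
    (Ω : Set (EuclideanSpace ℝ (Fin n)))
    (x₀ : EuclideanSpace ℝ (Fin n)) (y₀ : EuclideanSpace ℝ (Fin m)) : Prop :=
  ∃ U ∈ 𝓝 (x₀, y₀), ∃ S ⊆ eqIdx ℓ p,
    (LinearIndepOn ℝ (gradY h x₀ y₀) (S : Set (Fin p)) ∧
      Submodule.span ℝ (gradY h x₀ y₀ '' (S : Set (Fin p))) =
        Submodule.span ℝ (gradY h x₀ y₀ '' (eqIdx ℓ p : Set (Fin p)))) ∧
    (∃ r : ℕ, ∀ x y, (x, y) ∈ U → x ∈ Ω →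
      Module.finrank ℝ
        (Submodule.span ℝ (gradY h x y '' (eqIdx ℓ p : Set (Fin p)))) = r) ∧
    (∀ K ⊆ activeIdx ℓ h x₀ y₀, PosLinDep K (gradY h x₀ y₀) S (gradY h x₀ y₀) →
      ∀ x y, (x, y) ∈ U → x ∈ Ω →
        ¬ LinearIndepOn ℝ (gradY h x y) ((K : Set (Fin p)) ∪ (S : Set (Fin p))))

end ParamOpt

open ParamOpt

namespace ParamOpt

/-! ### Approximate multipliers for projections onto constraint sets -/

theorem hasDerivAt_max_zero_sq (t : ℝ) :
    HasDerivAt (fun s : ℝ => (max s 0) ^ 2) (2 * max t 0) t := by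
  rcases lt_trichotomy t 0 with ht | rfl | ht
  · have h0 : HasDerivAt (fun _ : ℝ => (0 : ℝ)) 0 t := hasDerivAt_const t 0
    rw [max_eq_right ht.le, mul_zero]
    refine h0.congr_of_eventuallyEq ?_
    filter_upwards [Iio_mem_nhds ht] with s hs
    rw [max_eq_right (le_of_lt hs)]
    simp
  · rw [max_self, mul_zero, hasDerivAt_iff_isLittleO]
    have h2 : (fun s : ℝ => s ^ 2) =o[𝓝 0] fun s : ℝ => s := by
      simpa using Asymptotics.isLittleO_pow_pow (𝕜 := ℝ) (m := 1) (n := 2) (by norm_num)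
    refine (Asymptotics.IsBigO.of_bound 1 (Eventually.of_forall fun s => ?_)).trans_isLittleO
      (g := fun s : ℝ => s ^ 2) (by simpa using h2)
    rcases le_total s 0 with hs | hs
    · simp [max_eq_right hs, sq_nonneg]
    · simp [max_eq_left hs]
  · rw [max_eq_left ht.le]
    have h0 : HasDerivAt (fun s : ℝ => s ^ 2) (2 * t) t := by
      simpa using hasDerivAt_pow 2 t
    refine h0.congr_of_eventuallyEq ?_
    filter_upwards [Ioi_mem_nhds ht] with s hs
    rw [max_eq_left (le_of_lt hs)]

theorem exists_penalty_pos {X : Type*} [TopologicalSpace X] {K : Set X} (hK : IsCompact K)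
    {G P : X → ℝ} (hG : Continuous G) (hP : Continuous P) (hP0 : ∀ u, 0 ≤ P u)
    (hpos : ∀ u ∈ K, P u = 0 → 0 < G u) : ∃ k : ℕ, ∀ u ∈ K, 0 < G u + k * P u := by
  have hcover : K ⊆ ⋃ k : ℕ, {u | 0 < G u + k * P u} := by
    intro u hu
    rw [Set.mem_iUnion]
    rcases (hP0 u).eq_or_lt with h0 | h0
    · exact ⟨0, by simpa using hpos u hu h0.symm⟩
    · obtain ⟨k, hk⟩ := exists_nat_gt (-G u / P u)
      refine ⟨k, ?_⟩
      rw [div_lt_iff₀ h0] at hk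
      simp only [Set.mem_ofPred_eq]
      linarith
  have hdir : Directed (· ⊆ ·) fun k : ℕ => {u | 0 < G u + k * P u} := by
    refine Monotone.directed_le (α := ℕ) (β := Set X) fun a b hab u hu => ?_
    have h1 : (a : ℝ) * P u ≤ b * P u :=
      mul_le_mul_of_nonneg_right (by exact_mod_cast hab) (hP0 u)
    simp only [Set.mem_ofPred_eq] at hu ⊢
    linarith
  obtain ⟨k, hk⟩ := hK.elim_directed_cover _
    (fun k => isOpen_lt continuous_const (hG.add (continuous_const.mul hP))) hcover hdir
  exact ⟨k, fun u hu => hk hu⟩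

section Projection

variable {E ι : Type*} [NormedAddCommGroup E] [InnerProductSpace ℝ E] [FiniteDimensional ℝ E]

theorem exists_approx_multiplier (I J : Finset ι) {h : ι → E → ℝ}
    (hh : ∀ i, ContDiff ℝ 1 (h i)) {y v : E}
    (hvI : ∀ i ∈ I, h i v ≤ 0) (hvJ : ∀ i ∈ J, h i v = 0)
    (hmin : ∀ u, (∀ i ∈ I, h i u ≤ 0) → (∀ i ∈ J, h i u = 0) → ‖v - y‖ ≤ ‖u - y‖)
    {N : Set E} (hN : N ∈ 𝓝 v) :
    ∃ w ∈ N, ∃ lam mu : ι → ℝ, (∀ i, 0 ≤ lam i) ∧ (∀ i, lam i ≠ 0 → 0 < h i w) ∧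
      y - w = ∑ i ∈ I, lam i • gradient (h i) w + ∑ i ∈ J, mu i • gradient (h i) w + (w - v) := by
  obtain ⟨ε, hε, hεN⟩ := Metric.nhds_basis_closedBall.mem_iff.1 hN
  have hc : ∀ i, Continuous (h i) := fun i => (hh i).continuous
  let P : E → ℝ := fun u => ∑ i ∈ I, (max (h i u) 0) ^ 2 + ∑ i ∈ J, (h i u) ^ 2
  let G : E → ℝ := fun u => ‖u - y‖ ^ 2 + ‖u - v‖ ^ 2 - ‖v - y‖ ^ 2
  have hP : Continuous P := by fun_prop
  have hG : Continuous G := by fun_prop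
  have hI0 : ∀ u, ∀ i ∈ I, 0 ≤ (max (h i u) 0) ^ 2 := fun u i _ => sq_nonneg _
  have hJ0 : ∀ u, ∀ i ∈ J, 0 ≤ (h i u) ^ 2 := fun u i _ => sq_nonneg _
  have hP0 : ∀ u, 0 ≤ P u := fun u =>
    add_nonneg (Finset.sum_nonneg (hI0 u)) (Finset.sum_nonneg (hJ0 u))
  obtain ⟨k, hk⟩ := exists_penalty_pos (isCompact_sphere v ε) hG hP hP0 (by
    intro u hu hPu
    have h1 := (add_eq_zero_iff_of_nonneg (Finset.sum_nonneg (hI0 u))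
      (Finset.sum_nonneg (hJ0 u))).1 hPu
    have hle := hmin u
      (fun i hi => by
        have := (Finset.sum_eq_zero_iff_of_nonneg (hI0 u)).1 h1.1 i hi
        have h3 : max (h i u) 0 = 0 := by simpa using this
        exact h3 ▸ le_max_left _ _)
      (fun i hi => by
        simpa using (Finset.sum_eq_zero_iff_of_nonneg (hJ0 u)).1 h1.2 i hi)
    have hu' : ‖u - v‖ = ε := by simpa [dist_eq_norm] using hu
    have h4 : ‖v - y‖ ^ 2 ≤ ‖u - y‖ ^ 2 := by gcongr
    have h5 : 0 < ‖u - v‖ ^ 2 := by rw [hu']; positivity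
    simp only [G]
    linarith)
  have hGv : G v + k * P v = 0 := by
    have h1 : ∑ i ∈ I, (max (h i v) 0) ^ 2 = 0 :=
      Finset.sum_eq_zero fun i hi => by rw [max_eq_right (hvI i hi)]; simp
    have h2 : ∑ i ∈ J, (h i v) ^ 2 = 0 :=
      Finset.sum_eq_zero fun i hi => by rw [hvJ i hi]; simp
    simp [G, P, h1, h2]
  obtain ⟨w, hw, hwmin⟩ := (isCompact_closedBall v ε).exists_isMinOn
    ⟨v, Metric.mem_closedBall_self hε.le⟩
    (f := fun u => G u + k * P u) (by fun_prop)
  have hwball : w ∈ Metric.ball v ε := by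
    rcases (Metric.mem_closedBall.1 hw).lt_or_eq with h1 | h1
    · exact h1
    · have h2 := hk w h1
      have h3 : G w + k * P w ≤ G v + k * P v := hwmin (Metric.mem_closedBall_self hε.le)
      linarith
  have hloc : IsLocalMin (fun u => G u + k * P u) w :=
    hwmin.isLocalMin (Metric.closedBall_mem_nhds_of_mem hwball)
  have hd : ∀ i, HasFDerivAt (h i) (fderiv ℝ (h i) w) w := fun i =>
    ((hh i).differentiable one_ne_zero).differentiableAt.hasFDerivAt
  have hd1 : ∀ i, HasFDerivAt (fun u => (max (h i u) 0) ^ 2)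
      ((2 * max (h i w) 0) • fderiv ℝ (h i) w) w := fun i =>
    (hasDerivAt_max_zero_sq (h i w)).comp_hasFDerivAt w (hd i)
  have hd2 : ∀ i, HasFDerivAt (fun u => (h i u) ^ 2)
      ((2 * h i w) • fderiv ℝ (h i) w) w := fun i => by
    have h1 := (hasDerivAt_pow 2 (h i w)).comp_hasFDerivAt w (hd i)
    simp only [Nat.cast_ofNat, Nat.add_one_sub_one, pow_one] at h1
    exact h1
  have hsq : ∀ a : E, HasFDerivAt (fun u => ‖u - a‖ ^ 2) ((2 : ℝ) • innerSL ℝ (w - a)) w := by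
    intro a
    have h1 := ((hasFDerivAt_id w).sub_const a).norm_sq
    rw [← Nat.cast_smul_eq_nsmul ℝ] at h1
    simpa using h1
  have hF : HasFDerivAt (fun u => G u + k * P u)
      (((2 : ℝ) • innerSL ℝ (w - y) + (2 : ℝ) • innerSL ℝ (w - v)) + (k : ℝ) •
        (∑ i ∈ I, (2 * max (h i w) 0) • fderiv ℝ (h i) w +
          ∑ i ∈ J, (2 * h i w) • fderiv ℝ (h i) w)) w := by
    refine HasFDerivAt.add (((hsq y).add (hsq v)).sub_const _) (HasFDerivAt.const_mul ?_ _)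
    exact (HasFDerivAt.fun_sum fun i _ => hd1 i).add (HasFDerivAt.fun_sum fun i _ => hd2 i)
  have h0 := hloc.hasFDerivAt_eq_zero hF
  refine ⟨w, hεN hw, fun i => k * max (h i w) 0, fun i => k * h i w, fun i => by positivity, ?_, ?_⟩
  · intro i hi
    by_contra hle
    exact hi (by simp [max_eq_right (not_lt.1 hle)])
  · refine ext_inner_right ℝ fun z => ?_
    have hz := congrArg (fun T : E →L[ℝ] ℝ => T z) h0
    simp only [_root_.add_apply, _root_.smul_apply,
      _root_.sum_apply, innerSL_apply_apply, smul_eq_mul,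
      _root_.zero_apply, mul_assoc, ← Finset.mul_sum] at hz
    simp only [inner_add_left, sum_inner, real_inner_smul_left, inner_gradient_left, mul_assoc,
      ← Finset.mul_sum]
    rw [inner_sub_left] at hz ⊢
    rw [inner_sub_left] at hz ⊢
    linarith

end Projection

/-! ### Conic combinations relative to a linearly independent family -/

section Conic

variable {E ι : Type*} [AddCommGroup E] [Module ℝ E] [DecidableEq ι]

theorem exists_linearIndepOn_conic_combination {g : ι → E} {B : Finset ι}
    (hB : LinearIndepOn ℝ g (B : Set ι)) (K : Finset ι) (hKB : Disjoint K B) (a : ι → ℝ)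
    (ha : ∀ i ∈ K, 0 ≤ a i) :
    ∃ K' ⊆ K, ∃ a' : ι → ℝ, (∀ i ∈ K', 0 ≤ a' i) ∧
      LinearIndepOn ℝ g ((K' : Set ι) ∪ (B : Set ι)) ∧
      ∑ i ∈ K', a' i • g i + ∑ i ∈ B, a' i • g i = ∑ i ∈ K, a i • g i + ∑ i ∈ B, a i • g i := by
  induction K using Finset.strongInduction generalizing a with
  | H K ih =>
    by_cases hli : LinearIndepOn ℝ g ((K : Set ι) ∪ (B : Set ι))
    · exact ⟨K, subset_rfl, a, ha, hli, rfl⟩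
    obtain ⟨c, hc0, hcK⟩ : ∃ c : ι → ℝ, ∑ i ∈ K, c i • g i + ∑ i ∈ B, c i • g i = 0 ∧
        ∃ i ∈ K, 0 < c i := by
      rw [← Finset.coe_union, linearIndepOn_finset_iff] at hli
      push Not at hli
      obtain ⟨c, hc, i, hi, hci⟩ := hli
      rw [Finset.sum_union hKB] at hc
      have hex : ∃ i ∈ K, c i ≠ 0 := by
        by_contra hno
        push Not at hno
        rw [Finset.sum_eq_zero (s := K) fun j hj => by rw [hno j hj, zero_smul], zero_add] at hc
        have := linearIndepOn_finset_iff.1 hB c hc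
        rcases Finset.mem_union.1 hi with h | h
        · exact hci (hno i h)
        · exact hci (this i h)
      obtain ⟨j, hj, hcj⟩ := hex
      rcases hcj.lt_or_gt with h | h
      · refine ⟨fun i => -c i, ?_, j, hj, by simpa using h⟩
        simp only [neg_smul, Finset.sum_neg_distrib]
        rw [← neg_add, hc, neg_zero]
      · exact ⟨c, hc, j, hj, h⟩
    obtain ⟨i₀, hi₀, hi₀c⟩ := hcK
    obtain ⟨j, hj, hjmin⟩ := Finset.exists_min_image (K.filter fun i => 0 < c i)
      (fun i => a i / c i) ⟨i₀, Finset.mem_filter.2 ⟨hi₀, hi₀c⟩⟩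
    obtain ⟨hjK, hcj⟩ := Finset.mem_filter.1 hj
    let b : ι → ℝ := fun i => a i - a j / c j * c i
    have hb : ∀ i ∈ K, 0 ≤ b i := by
      intro i hi
      rcases le_or_gt (c i) 0 with h | h
      · have h1 : a j / c j * c i ≤ 0 :=
          mul_nonpos_of_nonneg_of_nonpos (div_nonneg (ha j hjK) hcj.le) h
        have := ha i hi
        simp only [b]
        linarith
      · have h1 := hjmin i (Finset.mem_filter.2 ⟨hi, h⟩)
        rw [le_div_iff₀ h] at h1
        simp only [b]
        linarith
    have hbj : b j = 0 := by simp [b, hcj.ne']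
    have hsum : ∑ i ∈ K.erase j, b i • g i + ∑ i ∈ B, b i • g i =
        ∑ i ∈ K, a i • g i + ∑ i ∈ B, a i • g i := by
      rw [Finset.sum_erase K (by rw [hbj, zero_smul])]
      simp only [b, sub_smul, Finset.sum_sub_distrib, mul_smul, ← Finset.smul_sum]
      rw [sub_add_sub_comm, ← smul_add, hc0, smul_zero, sub_zero]
    obtain ⟨K', hK', a', ha', hli', hs'⟩ := ih (K.erase j) (Finset.erase_ssubset hjK)
      (hKB.mono_left (Finset.erase_subset _ _)) b (fun i hi => hb i (Finset.mem_of_mem_erase hi))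
    exact ⟨K', hK'.trans (Finset.erase_subset _ _), a', ha', hli', hs'.trans hsum⟩

end Conic

section Coercive

variable {E ι : Type*} [NormedAddCommGroup E] [NormedSpace ℝ E] [Fintype ι] [DecidableEq ι]

theorem exists_coercive_of_not_posLinDep {g : ι → E} {K B : Finset ι} (hKB : Disjoint K B)
    (hpld : ¬ PosLinDep K g B g) :
    ∃ c > (0 : ℝ), ∀ a : ι → ℝ, (∀ i ∈ K, 0 ≤ a i) →
      c * ∑ i ∈ K ∪ B, |a i| ≤ ‖∑ i ∈ K ∪ B, a i • g i‖ := by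
  let C : Set (ι → ℝ) := {a | (∀ i ∈ K, 0 ≤ a i) ∧ (∀ i, i ∉ K ∪ B → a i = 0) ∧
    ∑ i ∈ K ∪ B, |a i| = 1}
  have hle1 : ∀ a ∈ C, ∀ i, |a i| ≤ 1 := by
    rintro a ⟨-, h2, h3⟩ i
    by_cases hi : i ∈ K ∪ B
    · rw [← h3]
      exact Finset.single_le_sum (f := fun i => |a i|) (fun j _ => abs_nonneg _) hi
    · rw [h2 i hi]
      simp
  have hC : IsCompact C := by
    refine Metric.isCompact_of_isClosed_isBounded ?_ ?_
    · refine IsClosed.inter ?_ (IsClosed.inter ?_ ?_)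
      · have h1 : {a : ι → ℝ | ∀ i ∈ K, 0 ≤ a i} = ⋂ i ∈ K, {a | 0 ≤ a i} := by
          ext a
          simp
        change IsClosed {a : ι → ℝ | ∀ i ∈ K, 0 ≤ a i}
        rw [h1]
        exact isClosed_biInter fun i _ => isClosed_le continuous_const (continuous_apply i)
      · have h1 : {a : ι → ℝ | ∀ i, i ∉ K ∪ B → a i = 0} =
            ⋂ i ∈ {i | i ∉ K ∪ B}, {a | a i = 0} := by
          ext a
          simp
        change IsClosed {a : ι → ℝ | ∀ i, i ∉ K ∪ B → a i = 0}
        rw [h1]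
        exact isClosed_biInter fun i _ => isClosed_eq (continuous_apply i) continuous_const
      · exact isClosed_eq (by fun_prop) continuous_const
    · refine (Metric.isBounded_closedBall (x := (0 : ι → ℝ)) (r := 1)).subset fun a ha => ?_
      rw [mem_closedBall_zero_iff, pi_norm_le_iff_of_nonneg zero_le_one]
      exact hle1 a ha
  obtain ⟨c, hc, hcC⟩ : ∃ c > (0 : ℝ), ∀ a ∈ C, c ≤ ‖∑ i ∈ K ∪ B, a i • g i‖ := by
    rcases C.eq_empty_or_nonempty with hemp | hne
    · exact ⟨1, one_pos, fun a ha => by simp [hemp] at ha⟩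
    obtain ⟨a, ha, hamin⟩ := hC.exists_isMinOn hne
      (f := fun a : ι → ℝ => ‖∑ i ∈ K ∪ B, a i • g i‖) (by fun_prop)
    refine ⟨_, norm_pos_iff.2 fun h0 => hpld ?_, fun b hb => hamin hb⟩
    rw [Finset.sum_union hKB] at h0
    refine ⟨a, a, ha.1, ?_, h0⟩
    by_contra hno
    push Not at hno
    have : ∑ i ∈ K ∪ B, |a i| = 0 := Finset.sum_eq_zero fun i hi => by
      rcases Finset.mem_union.1 hi with h | h
      · simp [hno.1 i h]
      · simp [hno.2 i h]
    rw [ha.2.2] at this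
    exact one_ne_zero this
  refine ⟨c, hc, fun a ha => ?_⟩
  have hs0 : 0 ≤ ∑ i ∈ K ∪ B, |a i| := Finset.sum_nonneg fun i _ => abs_nonneg _
  rcases hs0.eq_or_lt with h0 | hs
  · rw [← h0, mul_zero]
    exact norm_nonneg _
  set s := ∑ i ∈ K ∪ B, |a i| with hsdef
  let b : ι → ℝ := fun i => if i ∈ K ∪ B then s⁻¹ * a i else 0
  have hb : ∀ i ∈ K ∪ B, b i = s⁻¹ * a i := fun i hi => if_pos hi
  have hbC : b ∈ C := by
    refine ⟨fun i hi => ?_, fun i hi => if_neg hi, ?_⟩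
    · rw [hb i (Finset.mem_union_left _ hi)]
      exact mul_nonneg (inv_nonneg.2 hs.le) (ha i hi)
    · rw [Finset.sum_congr rfl fun i hi => by rw [hb i hi, abs_mul, abs_of_pos (inv_pos.2 hs)],
        ← Finset.mul_sum, ← hsdef, inv_mul_cancel₀ hs.ne']
  have h1 := hcC b hbC
  rw [Finset.sum_congr rfl fun i hi => by rw [hb i hi, mul_smul], ← Finset.smul_sum, norm_smul,
    Real.norm_of_nonneg (inv_nonneg.2 hs.le), inv_mul_eq_div, le_div_iff₀ hs] at h1
  exact h1

end Coercive

theorem coercive_of_norm_sub_le {E ι : Type*} [NormedAddCommGroup E] [NormedSpace ℝ E] {g g' : ι → E} {T : Finset ι} {c η : ℝ}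
    (hg : ∀ i, ‖g' i - g i‖ ≤ η) {a : ι → ℝ}
    (hc : c * ∑ i ∈ T, |a i| ≤ ‖∑ i ∈ T, a i • g i‖) :
    (c - η) * ∑ i ∈ T, |a i| ≤ ‖∑ i ∈ T, a i • g' i‖ := by
  have h1 : ‖∑ i ∈ T, a i • g i‖ ≤ ‖∑ i ∈ T, a i • g' i‖ + η * ∑ i ∈ T, |a i| := by
    have h2 : ∑ i ∈ T, a i • g i = ∑ i ∈ T, a i • g' i - ∑ i ∈ T, a i • (g' i - g i) := by
      rw [← Finset.sum_sub_distrib]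
      exact Finset.sum_congr rfl fun i _ => by rw [← smul_sub, sub_sub_cancel]
    rw [h2]
    refine (norm_sub_le _ _).trans (add_le_add le_rfl ?_)
    refine (norm_sum_le _ _).trans ?_
    rw [Finset.mul_sum]
    refine Finset.sum_le_sum fun i _ => ?_
    rw [norm_smul, Real.norm_eq_abs, mul_comm]
    exact mul_le_mul_of_nonneg_right (hg i) (abs_nonneg _)
  linarith

section UniformCoercive

variable {E ι : Type*} [NormedAddCommGroup E] [NormedSpace ℝ E] [Fintype ι] [DecidableEq ι]

/-- One constant serves all the subsets `K` of `A` at once. -/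
theorem exists_uniform_coercive {g : ι → E} {A B : Finset ι} (hAB : Disjoint A B) :
    ∃ c > (0 : ℝ), ∀ K ⊆ A, ¬ PosLinDep K g B g → ∀ a : ι → ℝ, (∀ i ∈ K, 0 ≤ a i) →
      c * ∑ i ∈ K ∪ B, |a i| ≤ ‖∑ i ∈ K ∪ B, a i • g i‖ := by
  have hex : ∀ K : Finset ι, ∃ c > (0 : ℝ), K ⊆ A → ¬ PosLinDep K g B g → ∀ a : ι → ℝ,
      (∀ i ∈ K, 0 ≤ a i) → c * ∑ i ∈ K ∪ B, |a i| ≤ ‖∑ i ∈ K ∪ B, a i • g i‖ := by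
    intro K
    by_cases hK : K ⊆ A ∧ ¬ PosLinDep K g B g
    · obtain ⟨c, hc, h⟩ := exists_coercive_of_not_posLinDep (hAB.mono_left hK.1) hK.2
      exact ⟨c, hc, fun _ _ => h⟩
    · exact ⟨1, one_pos, fun h1 h2 => absurd ⟨h1, h2⟩ hK⟩
  choose c hc h using hex
  obtain ⟨K₀, -, hK₀⟩ := Finset.exists_min_image (Finset.univ : Finset (Finset ι)) c
    Finset.univ_nonempty
  refine ⟨c K₀, hc K₀, fun K hK hp a ha => le_trans ?_ (h K hK hp a ha)⟩
  exact mul_le_mul_of_nonneg_right (hK₀ K (Finset.mem_univ _))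
    (Finset.sum_nonneg fun i _ => abs_nonneg _)

end UniformCoercive

/-! ### A local error bound for feasible sets -/

section Regularity

variable {n m p : ℕ} {ℓ : ℕ}
  {h : Fin p → EuclideanSpace ℝ (Fin n) → EuclideanSpace ℝ (Fin m) → ℝ}

/-- The total violation of the constraints at `(x, y)`. -/
noncomputable def violation (ℓ : ℕ)
    (h : Fin p → EuclideanSpace ℝ (Fin n) → EuclideanSpace ℝ (Fin m) → ℝ)
    (x : EuclideanSpace ℝ (Fin n)) (y : EuclideanSpace ℝ (Fin m)) : ℝ :=
  ∑ i ∈ ineqIdx ℓ p, max (h i x y) 0 + ∑ i ∈ eqIdx ℓ p, |h i x y|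

theorem violation_nonneg (x : EuclideanSpace ℝ (Fin n)) (y : EuclideanSpace ℝ (Fin m)) :
    0 ≤ violation ℓ h x y :=
  add_nonneg (Finset.sum_nonneg fun _ _ => le_max_right _ _)
    (Finset.sum_nonneg fun _ _ => abs_nonneg _)

theorem le_violation_of_mem_ineqIdx {i : Fin p} (hi : i ∈ ineqIdx ℓ p)
    (x : EuclideanSpace ℝ (Fin n)) (y : EuclideanSpace ℝ (Fin m)) :
    h i x y ≤ violation ℓ h x y := by
  have h1 := Finset.single_le_sum (f := fun i => max (h i x y) 0)
    (fun j _ => le_max_right _ _) hi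
  have h2 : 0 ≤ ∑ i ∈ eqIdx ℓ p, |h i x y| := Finset.sum_nonneg fun _ _ => abs_nonneg _
  exact (le_max_left _ _).trans (h1.trans (le_add_of_nonneg_right h2))

theorem abs_le_violation_of_mem_eqIdx {i : Fin p} (hi : i ∈ eqIdx ℓ p)
    (x : EuclideanSpace ℝ (Fin n)) (y : EuclideanSpace ℝ (Fin m)) :
    |h i x y| ≤ violation ℓ h x y := by
  have h1 := Finset.single_le_sum (f := fun i => |h i x y|) (fun j _ => abs_nonneg _) hi
  have h2 : 0 ≤ ∑ i ∈ ineqIdx ℓ p, max (h i x y) 0 :=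
    Finset.sum_nonneg fun _ _ => le_max_right _ _
  exact h1.trans (le_add_of_nonneg_left h2)

theorem disjoint_ineqIdx_eqIdx (ℓ p : ℕ) : Disjoint (ineqIdx ℓ p) (eqIdx ℓ p) := by
  refine Finset.disjoint_left.2 fun i h1 h2 => ?_
  simp only [ineqIdx, eqIdx, Finset.mem_filter, Finset.mem_univ, true_and] at h1 h2
  omega

theorem contDiff_section
    (hh : ∀ i, ContDiff ℝ 1
      (fun z : EuclideanSpace ℝ (Fin n) × EuclideanSpace ℝ (Fin m) => h i z.1 z.2))
    (i : Fin p) (x : EuclideanSpace ℝ (Fin n)) : ContDiff ℝ 1 (h i x) :=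
  (hh i).comp (contDiff_const.prodMk contDiff_id)

theorem continuous_gradY
    (hh : ∀ i, ContDiff ℝ 1
      (fun z : EuclideanSpace ℝ (Fin n) × EuclideanSpace ℝ (Fin m) => h i z.1 z.2))
    (i : Fin p) :
    Continuous fun z : EuclideanSpace ℝ (Fin n) × EuclideanSpace ℝ (Fin m) =>
      gradY h z.1 z.2 i := by
  have hfd : ∀ z : EuclideanSpace ℝ (Fin n) × EuclideanSpace ℝ (Fin m),
      fderiv ℝ (h i z.1) z.2 =
        (fderiv ℝ (fun z : EuclideanSpace ℝ (Fin n) × EuclideanSpace ℝ (Fin m) => h i z.1 z.2)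
          z).comp (ContinuousLinearMap.inr ℝ _ _) := by
    intro z
    have h1 := ((hh i).differentiable one_ne_zero z).hasFDerivAt
    have h2 : HasFDerivAt (fun y => ((z.1, y) : EuclideanSpace ℝ (Fin n) × EuclideanSpace ℝ (Fin m)))
        (ContinuousLinearMap.inr ℝ _ _) z.2 := hasFDerivAt_prodMk_right z.1 z.2
    exact (HasFDerivAt.comp z.2 h1 h2).fderiv
  simp only [gradY, gradient, hfd]
  exact (LinearIsometryEquiv.continuous _).comp
    (((hh i).continuous_fderiv one_ne_zero).clm_comp continuous_const)

theorem abs_sub_sub_inner_gradient_le {E : Type*} [NormedAddCommGroup E] [InnerProductSpace ℝ E]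
    [CompleteSpace E] {q : E → ℝ} (hq : Differentiable ℝ q) {s : Set E} (hs : Convex ℝ s) {η : ℝ}
    {w : E} (hη : ∀ z ∈ s, ‖gradient q z - gradient q w‖ ≤ η) (hw : w ∈ s) {y : E} (hy : y ∈ s) :
    |q y - q w - inner ℝ (gradient q w) (y - w)| ≤ η * ‖y - w‖ := by
  rw [inner_gradient_left]
  refine hs.norm_image_sub_le_of_norm_fderiv_le' (𝕜 := ℝ) (fun z _ => hq z) (fun z hz => ?_) hw hy
  rw [← toDual_gradient, ← toDual_gradient, ← map_sub, LinearIsometryEquiv.norm_map]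
  exact hη z hz

theorem span_image_eq_of_finrank_eq {E ι : Type*} [AddCommGroup E] [Module ℝ E]
    [FiniteDimensional ℝ E] {g : ι → E} {B J : Finset ι} (hBJ : B ⊆ J)
    (hB : LinearIndepOn ℝ g (B : Set ι))
    (hr : Module.finrank ℝ (Submodule.span ℝ (g '' (J : Set ι))) = B.card) :
    Submodule.span ℝ (g '' (B : Set ι)) = Submodule.span ℝ (g '' (J : Set ι)) := by
  refine Submodule.eq_of_le_of_finrank_le
    (Submodule.span_mono (Set.image_mono (by exact_mod_cast hBJ))) ?_
  rw [hr, Set.image_eq_range]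
  exact (by simpa using (finrank_span_eq_card (R := ℝ) hB).ge)

theorem exists_local_error_bound
    (hh : ∀ i, ContDiff ℝ 1
      (fun z : EuclideanSpace ℝ (Fin n) × EuclideanSpace ℝ (Fin m) => h i z.1 z.2))
    {Ω : Set (EuclideanSpace ℝ (Fin n))}
    {x₀ : EuclideanSpace ℝ (Fin n)} (hx₀ : x₀ ∈ Ω) {y₀ : EuclideanSpace ℝ (Fin m)}
    (hR : RCPLD ℓ h Ω x₀ y₀) (hy₀ : y₀ ∈ feasible ℓ h x₀) :
    ∃ κ > (0 : ℝ), ∃ δ > (0 : ℝ), ∀ x ∈ Ω, dist x x₀ < δ → ∀ y v, dist y y₀ < δ →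
      dist v y₀ < δ → v ∈ feasible ℓ h x → (∀ u ∈ feasible ℓ h x, ‖v - y‖ ≤ ‖u - y‖) →
      ‖y - v‖ ≤ κ * violation ℓ h x y := by
  obtain ⟨U, hU, B, hBJ, ⟨hBli, hspan⟩, ⟨r, hr⟩, hK⟩ := hR
  have hAI : activeIdx ℓ h x₀ y₀ ⊆ ineqIdx ℓ p := Finset.filter_subset _ _
  have hAB : Disjoint (activeIdx ℓ h x₀ y₀) B :=
    (disjoint_ineqIdx_eqIdx ℓ p).mono hAI hBJ
  obtain ⟨c, hc, hcoer⟩ := exists_uniform_coercive (g := gradY h x₀ y₀) hAB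
  have hev : ∀ᶠ z in 𝓝 (x₀, y₀), z ∈ U ∧
      (∀ i, ‖gradY h z.1 z.2 i - gradY h x₀ y₀ i‖ ≤ c / 24) ∧
      (∀ i, i ∈ ineqIdx ℓ p → i ∉ activeIdx ℓ h x₀ y₀ → h i z.1 z.2 < 0) := by
    refine Filter.Eventually.and hU (Filter.Eventually.and (eventually_all.2 fun i => ?_)
      (eventually_all.2 fun i => ?_))
    · have h1 := (continuous_gradY hh i).continuousAt (x := (x₀, y₀))
        (Metric.closedBall_mem_nhds (gradY h x₀ y₀ i) (by positivity : 0 < c / 24))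
      filter_upwards [h1] with z hz
      rwa [← dist_eq_norm]
    · by_cases hi : i ∈ ineqIdx ℓ p ∧ i ∉ activeIdx ℓ h x₀ y₀
      · have hlt : h i x₀ y₀ < 0 :=
          lt_of_le_of_ne (hy₀.1 i hi.1) fun h0 => hi.2 (Finset.mem_filter.2 ⟨hi.1, h0⟩)
        have h1 : ∀ᶠ z : EuclideanSpace ℝ (Fin n) × EuclideanSpace ℝ (Fin m) in 𝓝 (x₀, y₀),
            h i z.1 z.2 < 0 :=
          (hh i).continuous.continuousAt.eventually (Iio_mem_nhds hlt)
        filter_upwards [h1] with z hz _ _ using hz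
      · exact Eventually.of_forall fun z h1 h2 => absurd ⟨h1, h2⟩ hi
  obtain ⟨δ, hδ, hball⟩ := Metric.eventually_nhds_iff.1 hev
  have hbase := hball (y := (x₀, y₀)) (by simpa using hδ)
  have hrB : r = B.card := by
    rw [← hr x₀ y₀ hbase.1 hx₀, ← hspan, Set.image_eq_range]
    simpa using finrank_span_eq_card (R := ℝ) hBli
  have hBpld : ¬ PosLinDep ∅ (gradY h x₀ y₀) B (gradY h x₀ y₀) := by
    rintro ⟨α, β, -, hne, hsum⟩
    rw [Finset.sum_empty, zero_add] at hsum
    have h0 := linearIndepOn_finset_iff.1 hBli β hsum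
    rcases hne with ⟨i, hi, -⟩ | ⟨i, hi, hne⟩
    · simp at hi
    · exact hne (h0 i hi)
  refine ⟨6 / c, by positivity, δ, hδ, fun x hx hxδ y v hy hv hvf hmin => ?_⟩
  have hloc : ∀ w, dist w y₀ < δ → (x, w) ∈ U ∧
      (∀ i, ‖gradY h x w i - gradY h x₀ y₀ i‖ ≤ c / 24) ∧
      (∀ i, i ∈ ineqIdx ℓ p → i ∉ activeIdx ℓ h x₀ y₀ → h i x w < 0) := fun w hw =>
    hball (y := (x, w)) (by rw [Prod.dist_eq]; exact max_lt hxδ hw)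
  rcases (norm_nonneg (y - v)).eq_or_lt with hd0 | hd
  · rw [← hd0]
    exact mul_nonneg (by positivity) (violation_nonneg x y)
  refine le_of_forall_pos_le_add fun τ hτ => ?_
  set t : ℝ := τ / (6 / c + 1) with ht
  have ht0 : 0 < t := by positivity
  have hτt : τ = t * (6 / c + 1) := by rw [ht, div_mul_cancel₀]; positivity
  have hN : ∀ᶠ w in 𝓝 v, dist w y₀ < δ ∧ dist w v < t ∧ dist w v < ‖y - v‖ / 5 ∧
      ∀ i, i ∈ eqIdx ℓ p → |h i x w| < t := by
    refine Filter.Eventually.and (Metric.isOpen_ball.mem_nhds hv)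
      (Filter.Eventually.and (Metric.ball_mem_nhds v ht0)
      (Filter.Eventually.and (Metric.ball_mem_nhds v (by positivity)) (eventually_all.2 fun i => ?_)))
    by_cases hi : i ∈ eqIdx ℓ p
    · have h1 : ∀ᶠ w in 𝓝 v, |h i x w| < t :=
        (contDiff_section hh i x).continuous.abs.continuousAt.eventually
          (Iio_mem_nhds (by simpa [hvf.2 i hi] using ht0))
      filter_upwards [h1] with w hw _ using hw
    · exact Eventually.of_forall fun w h1 => absurd h1 hi
  obtain ⟨w, ⟨hwδ, hwt, hwd, hweq⟩, lam, mu, hlam, hlampos, hkkt⟩ :=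
    exists_approx_multiplier (ineqIdx ℓ p) (eqIdx ℓ p) (fun i => contDiff_section hh i x)
      hvf.1 hvf.2 (fun u h1 h2 => hmin u ⟨h1, h2⟩) hN
  obtain ⟨hwU, hwη, hwneg⟩ := hloc w hwδ
  rw [dist_eq_norm] at hwt hwd
  set G := gradY h x w with hG
  -- linear independence persists, so the span of the equality gradients is that of `B`
  have hGB : LinearIndepOn ℝ G (B : Set (Fin p)) := by
    rw [linearIndepOn_finset_iff]
    intro a ha i hi
    have h1 := coercive_of_norm_sub_le hwη (hcoer ∅ (Finset.empty_subset _) hBpld a (by simp))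
    rw [Finset.empty_union, ha, norm_zero] at h1
    have h2 : |a i| ≤ ∑ i ∈ B, |a i| :=
      Finset.single_le_sum (f := fun i => |a i|) (fun _ _ => abs_nonneg _) hi
    have h3 : ∑ i ∈ B, |a i| ≤ 0 := by
      by_contra hpos
      have : 0 < (c - c / 24) * ∑ i ∈ B, |a i| := mul_pos (by linarith) (not_le.1 hpos)
      linarith
    exact abs_nonpos_iff.1 (h2.trans h3)
  have hspanG := span_image_eq_of_finrank_eq hBJ hGB (by rw [← hrB]; exact hr x w hwU hx)
  obtain ⟨nu, hnu⟩ : ∃ nu : Fin p → ℝ, ∑ i ∈ B, nu i • G i = ∑ i ∈ eqIdx ℓ p, mu i • G i := by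
    have hmem : ∑ i ∈ eqIdx ℓ p, mu i • G i ∈ Submodule.span ℝ (G '' (B : Set (Fin p))) := by
      rw [hspanG]
      exact Submodule.sum_mem _ fun i hi => Submodule.smul_mem _ _
        (Submodule.subset_span ⟨i, hi, rfl⟩)
    exact (Submodule.mem_span_image_finset_iff_exists_fun' ℝ).1 hmem
  let K₀ := (ineqIdx ℓ p).filter fun i => 0 < h i x w
  have hK₀A : K₀ ⊆ activeIdx ℓ h x₀ y₀ := by
    intro i hi
    obtain ⟨h1, h2⟩ := Finset.mem_filter.1 hi
    by_contra hiA
    exact (hwneg i h1 hiA).not_gt h2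
  have hlamsum : ∑ i ∈ K₀, lam i • G i = ∑ i ∈ ineqIdx ℓ p, lam i • G i := by
    refine Finset.sum_subset (Finset.filter_subset _ _) fun i hi hiK => ?_
    have : lam i = 0 := by
      by_contra hne
      exact hiK (Finset.mem_filter.2 ⟨hi, hlampos i hne⟩)
    rw [this, zero_smul]
  have hK₀B : Disjoint K₀ B := hAB.mono_left hK₀A
  obtain ⟨K, hKK₀, a, ha, hKli, hasum⟩ := exists_linearIndepOn_conic_combination hGB K₀ hK₀B
    (fun i => if i ∈ B then nu i else lam i)
    (fun i hi => by simpa [Finset.disjoint_left.1 hK₀B hi] using hlam i)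
  have hKA := hKK₀.trans hK₀A
  have hK₀sum : ∑ i ∈ K₀, (if i ∈ B then nu i else lam i) • G i = ∑ i ∈ K₀, lam i • G i :=
    Finset.sum_congr rfl fun i hi => by rw [if_neg (Finset.disjoint_left.1 hK₀B hi)]
  have hBsum : ∑ i ∈ B, (if i ∈ B then nu i else lam i) • G i = ∑ i ∈ B, nu i • G i :=
    Finset.sum_congr rfl fun i hi => by rw [if_pos hi]
  rw [hK₀sum, hBsum, hlamsum, hnu, ← Finset.sum_union (hAB.mono_left hKA)] at hasum
  have hkkt' : y - w = ∑ i ∈ K ∪ B, a i • G i + (w - v) := by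
    rw [hasum]
    exact hkkt
  have hnpld : ¬ PosLinDep K (gradY h x₀ y₀) B (gradY h x₀ y₀) := fun hp =>
    hK K hKA hp x w hwU hx hKli
  have hM := coercive_of_norm_sub_le hwη (hcoer K hKA hnpld a ha)
  set M := ∑ i ∈ K ∪ B, |a i| with hMdef
  have hM0 : 0 ≤ M := Finset.sum_nonneg fun _ _ => abs_nonneg _
  set D := ‖y - w‖ with hD
  set V := violation ℓ h x y with hV
  have hV0 : 0 ≤ V := violation_nonneg x y
  have hdD : ‖y - v‖ ≤ D + ‖w - v‖ := by
    have := norm_add_le (y - w) (w - v)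
    rwa [sub_add_sub_cancel] at this
  have hSnorm : ‖∑ i ∈ K ∪ B, a i • G i‖ ≤ D + ‖w - v‖ := by
    have h1 : ∑ i ∈ K ∪ B, a i • G i = (y - w) - (w - v) := eq_sub_of_add_eq hkkt'.symm
    rw [h1]
    exact norm_sub_le _ _
  have hD0 : 0 < D := by linarith
  have hwD : ‖w - v‖ ≤ D / 4 := by linarith
  have hMD : M * c ≤ 3 * D := by nlinarith
  have hterm : ∀ i ∈ K ∪ B, a i * inner ℝ (G i) (y - w) ≤ |a i| * (V + t + c / 12 * D) := by
    intro i hi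
    have hmv : |h i x y - h i x w - inner ℝ (G i) (y - w)| ≤ c / 12 * D := by
      refine abs_sub_sub_inner_gradient_le ((contDiff_section hh i x).differentiable one_ne_zero)
        (convex_ball y₀ δ) (fun z hz => ?_) hwδ hy
      have h1 := norm_sub_le_norm_sub_add_norm_sub (gradY h x z i) (gradY h x₀ y₀ i) (gradY h x w i)
      have h2 := (hloc z hz).2.1 i
      have h3 := hwη i
      rw [norm_sub_rev] at h3
      change ‖gradY h x z i - gradY h x w i‖ ≤ _
      linarith
    obtain ⟨hmv1, hmv2⟩ := abs_le.1 hmv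
    rcases Finset.mem_union.1 hi with hiK | hiB
    · obtain ⟨hiI, hpos⟩ := Finset.mem_filter.1 (hKK₀ hiK)
      rw [abs_of_nonneg (ha i hiK)]
      refine mul_le_mul_of_nonneg_left ?_ (ha i hiK)
      have := le_violation_of_mem_ineqIdx (h := h) hiI x y
      linarith
    · have h1 := abs_le.1 (abs_le_violation_of_mem_eqIdx (h := h) (hBJ hiB) x y)
      have h2 := abs_lt.1 (hweq i (hBJ hiB))
      refine (le_abs_self _).trans ?_
      rw [abs_mul]
      refine mul_le_mul_of_nonneg_left (abs_le.2 ⟨?_, ?_⟩) (abs_nonneg _) <;> linarith [h1.1, h1.2]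
  have hmain : D ^ 2 ≤ M * (V + t + c / 12 * D) + D / 4 * D := by
    have h1 : D ^ 2 = inner ℝ (∑ i ∈ K ∪ B, a i • G i) (y - w) + inner ℝ (w - v) (y - w) := by
      rw [← inner_add_left, ← hkkt', real_inner_self_eq_norm_sq]
    have h2 : inner ℝ (∑ i ∈ K ∪ B, a i • G i) (y - w) ≤ M * (V + t + c / 12 * D) := by
      rw [sum_inner, hMdef, Finset.sum_mul]
      refine Finset.sum_le_sum fun i hi => ?_
      rw [real_inner_smul_left]
      exact hterm i hi
    have h3 : inner ℝ (w - v) (y - w) ≤ D / 4 * D :=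
      (real_inner_le_norm _ _).trans (mul_le_mul_of_nonneg_right hwD hD0.le)
    linarith
  have hMc : M ≤ 3 * D / c := (le_div_iff₀ hc).2 hMD
  have hfin : D ≤ 6 / c * (V + t) := by
    have h1 : M * (V + t) ≤ 3 * D / c * (V + t) := mul_le_mul_of_nonneg_right hMc (by linarith)
    have h2 : M * (c / 12 * D) ≤ D / 4 * D := by nlinarith
    have h3 : D * D ≤ D * (6 / c * (V + t)) := by
      have : D * (6 / c * (V + t)) = 2 * (3 * D / c * (V + t)) := by ring
      rw [this]
      nlinarith
    exact le_of_mul_le_mul_left h3 hD0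
  rw [hτt]
  linarith

end Regularity

/-! ### Lipschitz continuity of the optimal value function -/

section Value

variable {n m p : ℕ} {ℓ : ℕ}
  {f : EuclideanSpace ℝ (Fin n) → EuclideanSpace ℝ (Fin m) → ℝ}
  {h : Fin p → EuclideanSpace ℝ (Fin n) → EuclideanSpace ℝ (Fin m) → ℝ}

theorem isClosed_graph_feasible
    (hc : ∀ i, Continuous
      (fun z : EuclideanSpace ℝ (Fin n) × EuclideanSpace ℝ (Fin m) => h i z.1 z.2)) :
    IsClosed {z : EuclideanSpace ℝ (Fin n) × EuclideanSpace ℝ (Fin m) |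
      z.2 ∈ feasible ℓ h z.1} := by
  have h1 : {z : EuclideanSpace ℝ (Fin n) × EuclideanSpace ℝ (Fin m) | z.2 ∈ feasible ℓ h z.1} =
      (⋂ i ∈ ineqIdx ℓ p, {z | h i z.1 z.2 ≤ 0}) ∩ ⋂ i ∈ eqIdx ℓ p, {z | h i z.1 z.2 = 0} := by
    ext z
    simp [feasible]
  rw [h1]
  exact (isClosed_biInter fun i _ => isClosed_le (hc i) continuous_const).inter
    (isClosed_biInter fun i _ => isClosed_eq (hc i) continuous_const)

theorem isClosed_feasible
    (hc : ∀ i, Continuous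
      (fun z : EuclideanSpace ℝ (Fin n) × EuclideanSpace ℝ (Fin m) => h i z.1 z.2))
    (x : EuclideanSpace ℝ (Fin n)) : IsClosed (feasible ℓ h x) :=
  (isClosed_graph_feasible hc).preimage (Continuous.prodMk_right x)

theorem exists_projection {E : Type*} [NormedAddCommGroup E] [ProperSpace E] {s : Set E}
    (hs : IsClosed s) (hne : s.Nonempty) (y : E) :
    ∃ v ∈ s, ∀ u ∈ s, ‖v - y‖ ≤ ‖u - y‖ := by
  obtain ⟨v, hv, hd⟩ := hs.exists_infDist_eq_dist hne y
  refine ⟨v, hv, fun u hu => ?_⟩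
  rw [← dist_eq_norm, ← dist_eq_norm, dist_comm v, dist_comm u, ← hd]
  exact Metric.infDist_le_dist_of_mem hu

theorem optValue_eq_of_mem_solution {x : EuclideanSpace ℝ (Fin n)} {y : EuclideanSpace ℝ (Fin m)}
    (hy : y ∈ solution ℓ f h x) : optValue ℓ f h x = (f x y : EReal) :=
  le_antisymm (iInf₂_le y hy.1) (le_iInf₂ fun z hz => EReal.coe_le_coe_iff.2 (hy.2 z hz))

theorem locallyLipschitzAtWrt_optValue_of_selection {Ω : Set (EuclideanSpace ℝ (Fin n))}
    {x₀ : EuclideanSpace ℝ (Fin n)} {δ L : ℝ} (hδ : 0 < δ) (hL : 0 < L)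
    (H : ∀ x ∈ Ω, dist x x₀ < δ → ∃ y ∈ solution ℓ f h x, ∀ x' ∈ Ω,
      dist x' x₀ < δ → ∃ v ∈ feasible ℓ h x', f x' v ≤ f x y + L * ‖x - x'‖) :
    LocallyLipschitzAtWrt (optValue ℓ f h) Ω x₀ := by
  have hle : ∀ x ∈ Metric.ball x₀ δ ∩ Ω, ∀ x' ∈ Metric.ball x₀ δ ∩ Ω,
      (optValue ℓ f h x').toReal ≤ (optValue ℓ f h x).toReal + L * ‖x - x'‖ := by
    rintro x ⟨hx, hxΩ⟩ x' ⟨hx', hxΩ'⟩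
    obtain ⟨y, hy, hsel⟩ := H x hxΩ hx
    obtain ⟨v, hv, hle⟩ := hsel x' hxΩ' hx'
    obtain ⟨y', hy', -⟩ := H x' hxΩ' hx'
    rw [optValue_eq_of_mem_solution hy, optValue_eq_of_mem_solution hy', EReal.toReal_coe,
      EReal.toReal_coe]
    exact (hy'.2 v hv).trans hle
  refine ⟨δ, hδ, L, hL, ?_, fun x hx x' hx' => ?_⟩
  · rintro x ⟨hx, hxΩ⟩
    obtain ⟨y, hy, -⟩ := H x hxΩ hx
    rw [optValue_eq_of_mem_solution hy]
    exact ⟨EReal.coe_ne_bot _, EReal.coe_ne_top _⟩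
  · have h1 := hle x hx x' hx'
    have h2 := hle x' hx' x hx
    rw [norm_sub_rev] at h2
    rw [abs_le]
    constructor <;> linarith

theorem exists_violation_le
    (hh : ∀ i, ContDiff ℝ 1
      (fun z : EuclideanSpace ℝ (Fin n) × EuclideanSpace ℝ (Fin m) => h i z.1 z.2))
    {s : Set (EuclideanSpace ℝ (Fin n) × EuclideanSpace ℝ (Fin m))} (hs : Convex ℝ s)
    (hsc : IsCompact s) :
    ∃ L : ℝ, 0 ≤ L ∧ ∀ x x' y, (x, y) ∈ s → (x', y) ∈ s → y ∈ feasible ℓ h x →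
      violation ℓ h x' y ≤ L * ‖x - x'‖ := by
  choose K hK using fun i => (hh i).contDiffOn.exists_lipschitzOnWith one_ne_zero hs hsc
  refine ⟨∑ i ∈ ineqIdx ℓ p, (K i : ℝ) + ∑ i ∈ eqIdx ℓ p, (K i : ℝ), by positivity, ?_⟩
  intro x x' y hxy hx'y hy
  have hdist : ∀ i, |h i x' y - h i x y| ≤ K i * ‖x - x'‖ := by
    intro i
    have h1 := (hK i).dist_le_mul _ hx'y _ hxy
    rwa [Prod.dist_eq, dist_self, max_eq_left dist_nonneg, dist_comm x', dist_eq_norm x,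
      Real.dist_eq] at h1
  rw [add_mul, Finset.sum_mul, Finset.sum_mul]
  refine add_le_add (Finset.sum_le_sum fun i hi => max_le ?_ (by positivity))
    (Finset.sum_le_sum fun i hi => ?_)
  · have := (abs_le.1 (hdist i)).2
    have := hy.1 i hi
    linarith
  · have := hdist i
    rwa [hy.2 i hi, sub_zero] at this

theorem locallyLipschitzAtWrt_optValue_of_error_bound
    (hf : ContDiff ℝ 1
      (fun z : EuclideanSpace ℝ (Fin n) × EuclideanSpace ℝ (Fin m) => f z.1 z.2))
    (hh : ∀ i, ContDiff ℝ 1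
      (fun z : EuclideanSpace ℝ (Fin n) × EuclideanSpace ℝ (Fin m) => h i z.1 z.2))
    {Ω : Set (EuclideanSpace ℝ (Fin n))} {x₀ : EuclideanSpace ℝ (Fin n)}
    {y₀ : EuclideanSpace ℝ (Fin m)} {δ κ R : ℝ} (hδ : 0 < δ) (hκ : 0 ≤ κ)
    (H : ∀ x ∈ Ω, dist x x₀ < δ → ∃ y ∈ solution ℓ f h x, dist y y₀ ≤ R ∧ ∀ x' ∈ Ω,
      dist x' x₀ < δ → ∃ v ∈ feasible ℓ h x', dist v y₀ ≤ R ∧ ‖y - v‖ ≤ κ * violation ℓ h x' y) :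
    LocallyLipschitzAtWrt (optValue ℓ f h) Ω x₀ := by
  have hs : Convex ℝ (Metric.closedBall x₀ δ ×ˢ Metric.closedBall y₀ R) :=
    (convex_closedBall _ _).prod (convex_closedBall _ _)
  have hsc : IsCompact (Metric.closedBall x₀ δ ×ˢ Metric.closedBall y₀ R) :=
    (isCompact_closedBall _ _).prod (isCompact_closedBall _ _)
  obtain ⟨L, hL, hviol⟩ := exists_violation_le (ℓ := ℓ) hh hs hsc
  obtain ⟨C, hC⟩ := hf.contDiffOn.exists_lipschitzOnWith one_ne_zero hs hsc
  refine locallyLipschitzAtWrt_optValue_of_selection hδ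
    (L := C * (1 + κ * L) + 1) (by positivity) fun x hx hxδ => ?_
  obtain ⟨y, hy, hyR, hsel⟩ := H x hx hxδ
  refine ⟨y, hy, fun x' hx' hx'δ => ?_⟩
  obtain ⟨v, hv, hvR, hyv⟩ := hsel x' hx' hx'δ
  refine ⟨v, hv, ?_⟩
  have h1 := hviol x x' y ⟨hxδ.le, hyR⟩ ⟨hx'δ.le, hyR⟩ hy.1
  have h2 : ‖y - v‖ ≤ κ * L * ‖x - x'‖ := by
    refine hyv.trans ?_
    rw [mul_assoc]
    exact mul_le_mul_of_nonneg_left h1 hκ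
  have h3 := hC.dist_le_mul (x', v) ⟨hx'δ.le, hvR⟩ (x, y) ⟨hxδ.le, hyR⟩
  have h4 : dist (x', v) (x, y) ≤ (1 + κ * L) * ‖x - x'‖ := by
    rw [Prod.dist_eq, dist_comm, dist_comm v, dist_eq_norm, dist_eq_norm]
    have h5 : 0 ≤ κ * L * ‖x - x'‖ := by positivity
    refine max_le ?_ ?_ <;> linarith [norm_nonneg (x - x')]
  have h6 := h3.trans (mul_le_mul_of_nonneg_left h4 C.2)
  have h7 : f x' v - f x y ≤ C * ((1 + κ * L) * ‖x - x'‖) := (le_abs_self _).trans h6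
  linarith [norm_nonneg (x - x')]

theorem InnerSemicontinuousAt.exists_dist_lt {X Y : Type*} [PseudoMetricSpace X]
    [PseudoMetricSpace Y] {Υ : X → Set Y} {Ω : Set X} {x₀ : X} {y₀ : Y}
    (hΥ : InnerSemicontinuousAt Υ Ω x₀ y₀) {ε : ℝ} (hε : 0 < ε) :
    ∃ δ > (0 : ℝ), ∀ x ∈ Ω, dist x x₀ < δ → ∃ y ∈ Υ x, dist y y₀ < ε := by
  by_contra hno
  push Not at hno
  choose x hxΩ hxd hfar using fun k : ℕ => hno (1 / ((k : ℝ) + 1)) Nat.one_div_pos_of_nat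
  have hx : Tendsto x atTop (𝓝 x₀) := by
    rw [tendsto_iff_dist_tendsto_zero]
    exact squeeze_zero (fun _ => dist_nonneg) (fun k => (hxd k).le)
      tendsto_one_div_add_atTop_nhds_zero_nat
  obtain ⟨y, hy, hmem⟩ := hΥ x hxΩ hx
  obtain ⟨k, hk, hkd⟩ := (hmem.and (hy.eventually (Metric.ball_mem_nhds y₀ hε))).exists
  exact (hfar k (y k) hk).not_gt hkd

theorem locallyLipschitzAtWrt_optValue_of_innerSemicontinuousAt
    (hf : ContDiff ℝ 1
      (fun z : EuclideanSpace ℝ (Fin n) × EuclideanSpace ℝ (Fin m) => f z.1 z.2))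
    (hh : ∀ i, ContDiff ℝ 1
      (fun z : EuclideanSpace ℝ (Fin n) × EuclideanSpace ℝ (Fin m) => h i z.1 z.2))
    {x₀ : EuclideanSpace ℝ (Fin n)} (hx₀ : x₀ ∈ setDom (feasible ℓ h))
    {y₀ : EuclideanSpace ℝ (Fin m)} (hy₀ : y₀ ∈ feasible ℓ h x₀)
    (hS : InnerSemicontinuousAt (solution ℓ f h) (setDom (feasible ℓ h)) x₀ y₀)
    (hR : RCPLD ℓ h (setDom (feasible ℓ h)) x₀ y₀) :
    LocallyLipschitzAtWrt (optValue ℓ f h) (setDom (feasible ℓ h)) x₀ := by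
  obtain ⟨κ, hκ, δ, hδ, hbound⟩ := exists_local_error_bound hh hx₀ hR hy₀
  obtain ⟨ρ, hρ, hsel⟩ := hS.exists_dist_lt (ε := δ / 3) (by positivity)
  refine locallyLipschitzAtWrt_optValue_of_error_bound hf hh (y₀ := y₀) (R := δ)
    (lt_min hδ hρ) hκ.le fun x hx hxδ => ?_
  obtain ⟨y, hy, hyd⟩ := hsel x hx (hxδ.trans_le (min_le_right _ _))
  refine ⟨y, hy, by linarith, fun x' hx' hx'δ => ?_⟩
  obtain ⟨y', hy', hyd'⟩ := hsel x' hx' (hx'δ.trans_le (min_le_right _ _))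
  obtain ⟨v, hv, hmin⟩ := exists_projection
    (isClosed_feasible (ℓ := ℓ) (fun i => (hh i).continuous) x') hx' y
  have hvd : dist v y₀ < δ := by
    have h1 := hmin y' hy'.1
    rw [← dist_eq_norm, ← dist_eq_norm] at h1
    have h2 := dist_triangle v y y₀
    have h3 := dist_triangle_right y' y y₀
    linarith
  exact ⟨v, hv, hvd.le,
    hbound x' hx' (hx'δ.trans_le (min_le_left _ _)) y v (by linarith) hvd hv hmin⟩

theorem exists_uniform_error_bound
    (hh : ∀ i, ContDiff ℝ 1
      (fun z : EuclideanSpace ℝ (Fin n) × EuclideanSpace ℝ (Fin m) => h i z.1 z.2))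
    {Ω : Set (EuclideanSpace ℝ (Fin n))} {x₀ : EuclideanSpace ℝ (Fin n)} (hx₀ : x₀ ∈ Ω)
    (hR : ∀ y ∈ feasible ℓ h x₀, RCPLD ℓ h Ω x₀ y) {C : Set (EuclideanSpace ℝ (Fin m))}
    (hC : IsCompact C) :
    ∃ κ > (0 : ℝ), ∃ δ > (0 : ℝ), ∀ x ∈ Ω, dist x x₀ < δ → ∀ v ∈ C, v ∈ feasible ℓ h x →
      ∀ y, dist y v < δ → (∀ u ∈ feasible ℓ h x, ‖v - y‖ ≤ ‖u - y‖) →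
      ‖y - v‖ ≤ κ * violation ℓ h x y := by
  refine hC.induction_on ?_ ?_ ?_ ?_
  · exact ⟨1, one_pos, 1, one_pos, fun _ _ _ v hv => absurd hv (Set.notMem_empty v)⟩
  · rintro s t hst ⟨κ, hκ, δ, hδ, H⟩
    exact ⟨κ, hκ, δ, hδ, fun x hx hxδ v hv => H x hx hxδ v (hst hv)⟩
  · rintro s t ⟨κ, hκ, δ, hδ, H⟩ ⟨κ', hκ', δ', hδ', H'⟩
    refine ⟨max κ κ', lt_max_of_lt_left hκ, min δ δ', lt_min hδ hδ', ?_⟩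
    intro x hx hxδ v hv hvf y hyv hmin
    rw [lt_min_iff] at hxδ hyv
    rcases hv with hv | hv
    · exact (H x hx hxδ.1 v hv hvf y hyv.1 hmin).trans
        (mul_le_mul_of_nonneg_right (le_max_left _ _) (violation_nonneg x y))
    · exact (H' x hx hxδ.2 v hv hvf y hyv.2 hmin).trans
        (mul_le_mul_of_nonneg_right (le_max_right _ _) (violation_nonneg x y))
  · intro y₀ _
    by_cases hy₀ : y₀ ∈ feasible ℓ h x₀
    · obtain ⟨κ, hκ, δ, hδ, H⟩ := exists_local_error_bound hh hx₀ (hR y₀ hy₀) hy₀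
      refine ⟨Metric.ball y₀ (δ / 2), mem_nhdsWithin_of_mem_nhds
        (Metric.ball_mem_nhds _ (by positivity)), κ, hκ, δ / 2, by positivity, ?_⟩
      intro x hx hxδ v hv hvf y hyv hmin
      have hv' : dist v y₀ < δ / 2 := hv
      have := dist_triangle y v y₀
      exact H x hx (by linarith) y v (by linarith) (by linarith) hvf hmin
    · have hopen := (isClosed_graph_feasible (ℓ := ℓ) fun i => (hh i).continuous).isOpen_compl
      obtain ⟨δ, hδ, hball⟩ := Metric.isOpen_iff.1 hopen (x₀, y₀) hy₀
      refine ⟨Metric.ball y₀ δ, mem_nhdsWithin_of_mem_nhds (Metric.ball_mem_nhds _ hδ), 1,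
        one_pos, δ, hδ, ?_⟩
      intro x _ hxδ v hv hvf
      exact absurd hvf (hball (a := (x, v))
        (by rw [Metric.mem_ball, Prod.dist_eq]; exact max_lt hxδ hv))

theorem ConvexAffine.violation_segment_le (hca : ConvexAffine ℓ h) {x : EuclideanSpace ℝ (Fin n)}
    {v : EuclideanSpace ℝ (Fin m)} (hv : v ∈ feasible ℓ h x) (y : EuclideanSpace ℝ (Fin m))
    {t : ℝ} (ht0 : 0 ≤ t) (ht1 : t ≤ 1) :
    violation ℓ h x (AffineMap.lineMap v y t) ≤ t * violation ℓ h x y := by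
  obtain ⟨hconv, haff⟩ := hca x
  rw [violation, violation, mul_add, Finset.mul_sum, Finset.mul_sum]
  refine add_le_add (Finset.sum_le_sum fun i hi => max_le ?_ ?_) (Finset.sum_le_sum fun i hi => ?_)
  · have h1 := (hconv i hi).2 (Set.mem_univ v) (Set.mem_univ y) (sub_nonneg.2 ht1) ht0 (by ring)
    rw [← AffineMap.lineMap_apply_module, smul_eq_mul, smul_eq_mul] at h1
    have h2 : (1 - t) * h i x v ≤ 0 :=
      mul_nonpos_of_nonneg_of_nonpos (sub_nonneg.2 ht1) (hv.1 i hi)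
    have h3 : t * h i x y ≤ t * max (h i x y) 0 := mul_le_mul_of_nonneg_left (le_max_left _ _) ht0
    linarith
  · exact mul_nonneg ht0 (le_max_right _ _)
  · obtain ⟨A, hA⟩ := haff i hi
    have h1 : A v = 0 := by rw [← hA, hv.2 i hi]
    rw [hA, hA, AffineMap.apply_lineMap, h1, AffineMap.lineMap_apply_module, smul_zero, zero_add,
      smul_eq_mul, abs_mul, abs_of_nonneg ht0]

theorem norm_sub_lineMap_le_of_projection {E : Type*} [NormedAddCommGroup E] [NormedSpace ℝ E]
    {s : Set E} {y v : E} (hmin : ∀ u ∈ s, ‖v - y‖ ≤ ‖u - y‖) {t : ℝ} (ht0 : 0 ≤ t) (ht1 : t ≤ 1)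
    {u : E} (hu : u ∈ s) :
    ‖v - AffineMap.lineMap v y t‖ ≤ ‖u - AffineMap.lineMap v y t‖ := by
  have h1 := hmin u hu
  have h2 := dist_triangle u (AffineMap.lineMap v y t) y
  have h3 : dist (AffineMap.lineMap v y t) y = (1 - t) * dist v y := by
    rw [dist_lineMap_right, Real.norm_of_nonneg (sub_nonneg.2 ht1)]
  have h4 : dist v (AffineMap.lineMap v y t) = t * dist v y := by
    rw [dist_left_lineMap, Real.norm_of_nonneg ht0]
  rw [← dist_eq_norm, ← dist_eq_norm] at h1 ⊢
  rw [h4]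
  linarith

theorem locallyLipschitzAtWrt_optValue_of_convexAffine
    (hf : ContDiff ℝ 1
      (fun z : EuclideanSpace ℝ (Fin n) × EuclideanSpace ℝ (Fin m) => f z.1 z.2))
    (hh : ∀ i, ContDiff ℝ 1
      (fun z : EuclideanSpace ℝ (Fin n) × EuclideanSpace ℝ (Fin m) => h i z.1 z.2))
    {x₀ : EuclideanSpace ℝ (Fin n)} (hx₀ : x₀ ∈ setDom (feasible ℓ h))
    (hca : ConvexAffine ℓ h) (hbdd : LocallyBoundedAt (feasible ℓ h) x₀)
    (hR : ∀ y ∈ feasible ℓ h x₀, RCPLD ℓ h (setDom (feasible ℓ h)) x₀ y) :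
    LocallyLipschitzAtWrt (optValue ℓ f h) (setDom (feasible ℓ h)) x₀ := by
  obtain ⟨C, hC, U, hU, hUC⟩ := hbdd
  obtain ⟨R, hCR⟩ := hC.subset_closedBall 0
  obtain ⟨ρ, hρ, hρU⟩ := Metric.mem_nhds_iff.1 hU
  have hcl : ∀ x, IsClosed (feasible ℓ h x) := isClosed_feasible fun i => (hh i).continuous
  have hball : ∀ x, dist x x₀ < ρ → feasible ℓ h x ⊆ Metric.closedBall 0 R := fun x hx =>
    (hUC x (hρU hx)).trans hCR
  obtain ⟨κ, hκ, δ, hδ, H⟩ := exists_uniform_error_bound hh hx₀ hR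
    (isCompact_closedBall (0 : EuclideanSpace ℝ (Fin m)) R)
  refine locallyLipschitzAtWrt_optValue_of_error_bound hf hh (y₀ := 0) (R := R)
    (lt_min hδ hρ) hκ.le fun x hx hxδ => ?_
  rw [lt_min_iff] at hxδ
  have hfx : Continuous (f x) := hf.continuous.comp (Continuous.prodMk_right x)
  obtain ⟨y, hy, hymin⟩ := ((isCompact_closedBall (0 : EuclideanSpace ℝ (Fin m)) R).of_isClosed_subset
    (hcl x) (hball x hxδ.2)).exists_isMinOn hx hfx.continuousOn
  refine ⟨y, ⟨hy, fun z hz => hymin hz⟩, hball x hxδ.2 hy, fun x' hx' hx'δ => ?_⟩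
  rw [lt_min_iff] at hx'δ
  obtain ⟨v, hv, hmin⟩ := exists_projection (hcl x') hx' y
  refine ⟨v, hv, hball x' hx'δ.2 hv, ?_⟩
  rcases (norm_nonneg (y - v)).eq_or_lt with hd0 | hd
  · rw [← hd0]
    exact mul_nonneg hκ.le (violation_nonneg x' y)
  obtain ⟨t, ht0, ht1, htδ⟩ : ∃ t : ℝ, 0 < t ∧ t ≤ 1 ∧ t * ‖y - v‖ < δ := by
    refine ⟨min 1 (δ / 2 / ‖y - v‖), lt_min one_pos (by positivity), min_le_left _ _, ?_⟩
    have h1 := mul_le_mul_of_nonneg_right (min_le_right 1 (δ / 2 / ‖y - v‖)) hd.le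
    rw [div_mul_cancel₀ _ hd.ne'] at h1
    linarith
  have hdist : ‖AffineMap.lineMap v y t - v‖ = t * ‖y - v‖ := by
    rw [← dist_eq_norm, dist_lineMap_left, Real.norm_of_nonneg ht0.le, dist_comm, dist_eq_norm]
  have h1 := H x' hx' hx'δ.1 v (hball x' hx'δ.2 hv) hv (AffineMap.lineMap v y t)
    (by rw [dist_eq_norm, hdist]; exact htδ)
    (fun u hu => norm_sub_lineMap_le_of_projection hmin ht0.le ht1 hu)
  rw [hdist] at h1
  have h2 := mul_le_mul_of_nonneg_left (hca.violation_segment_le hv y ht0.le ht1) hκ.le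
  refine le_of_mul_le_mul_left ?_ ht0
  linarith

end Value

end ParamOpt

theorem mainTheorem9 (n m p ℓ : ℕ) (hℓ : ℓ ≤ p)
    (f : EuclideanSpace ℝ (Fin n) → EuclideanSpace ℝ (Fin m) → ℝ)
    (h : Fin p → EuclideanSpace ℝ (Fin n) → EuclideanSpace ℝ (Fin m) → ℝ)
    (hf : ContDiff ℝ 1
      (fun z : EuclideanSpace ℝ (Fin n) × EuclideanSpace ℝ (Fin m) => f z.1 z.2))
    (hh : ∀ i, ContDiff ℝ 1
      (fun z : EuclideanSpace ℝ (Fin n) × EuclideanSpace ℝ (Fin m) => h i z.1 z.2))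
    (x₀ : EuclideanSpace ℝ (Fin n)) (hx₀ : x₀ ∈ setDom (feasible ℓ h))
    (hab :
      (ConvexAffine ℓ h ∧ LocallyBoundedAt (feasible ℓ h) x₀ ∧
        ∀ y ∈ feasible ℓ h x₀, RCPLD ℓ h (setDom (feasible ℓ h)) x₀ y) ∨
      (∃ y₀ ∈ solution ℓ f h x₀,
        InnerSemicontinuousAt (solution ℓ f h) (setDom (feasible ℓ h)) x₀ y₀ ∧
        RCPLD ℓ h (setDom (feasible ℓ h)) x₀ y₀)) :
    LocallyLipschitzAtWrt (optValue ℓ f h) (setDom (feasible ℓ h)) x₀ := by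
  rcases hab with ⟨hca, hbdd, hR⟩ | ⟨y₀, hy₀, hS, hR⟩
  · exact locallyLipschitzAtWrt_optValue_of_convexAffine hf hh hx₀ hca hbdd hR
  · exact locallyLipschitzAtWrt_optValue_of_innerSemicontinuousAt hf hh hx₀ hy₀.1 hS hR
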